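/- Let $k\ge 2$ be an integer and let $\alpha\in\left(\frac1{k+1},\frac1k\right)$. Then there exists a constant $0<c<1$, depending only on $k$ and $\alpha$, such that the following holds. For each $n$ let $H_\alpha=H_{\alpha,n}$ be a complete bipartite graph on the vertex set $\{1,\dots,n\}$ with vertex classes $A$ and $B$ of sizes $\alpha n$ and $(1-\alpha)n$, where for each $n$ the number $\alpha n$ is rounded up or down to an integer $|A|$ and $|B|=n-|A|$. Let $p=p(n)\in[0,1]$ satisfy $$p\le c\,n^{-(k-1)/(2k-3)}$$ for all sufficiently large $n$, and let $G(n,p)$ be the binomial random graph on $\{1,\dots,n\}$, in which each pair of vertices is an edge independently with probability $p$. Then $$\lim_{n\to\infty}\mathbb P\big(H_\alpha\cup G(n,p)\text{ does not contain a copy of } C_n^2\big)=1,$$ where $C_n^2$, the square of the cycle $C_n$ on $n$ vertices, is the graph obtained from $C_n$ by adding an edge between every two vertices at distance two in $C_n$. -/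

import Mathlib

open Filter Topology

namespace PerturbedSquare

/-- The `r`-th power of a graph: two distinct vertices are adjacent iff their distance in `G` is at
most `r`. (`edist` is the graph distance, with value `⊤` for vertices in different components.) -/
def graphPower {V : Type*} (G : SimpleGraph V) (r : ℕ) : SimpleGraph V where
  Adj u v := u ≠ v ∧ G.edist u v ≤ (r : ℕ∞)
  symm := ⟨fun u v h => ⟨h.1.symm, by rw [SimpleGraph.edist_comm]; exact h.2⟩⟩
  loopless := ⟨fun _ h => h.1 rfl⟩

/-- The square of the cycle on `n` vertices. -/
def squareCycle (n : ℕ) : SimpleGraph (Fin n) :=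
  graphPower (SimpleGraph.cycleGraph n) 2

/-- The complete bipartite graph on the vertex set `V` with vertex classes `A` and `V \ A`. -/
def completeBipartiteOn {V : Type*} (A : Finset V) : SimpleGraph V :=
  (⊤ : SimpleGraph V).between (A : Set V) (A : Set V)ᶜ

end PerturbedSquare

/-!
The square of `C_n` contains `⌊n / k⌋` vertex-disjoint copies of the square of a path on `k`
vertices. A vertex of `A` meets at most one of them, so at least `m = ⌊n / k⌋ - |A|` copies avoid
`A`; every edge of the complete bipartite graph meets `A`, so in any embedding of the square of
`C_n` these copies consist of random edges. Unordered families of `m` disjoint copies number at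
most `(n ^ k) ^ m / m!`, and each appears with probability at most `p ^ ((2 * k - 3) * m)`. The
union bound is therefore `(n ^ k * p ^ (2 * k - 3)) ^ m / m! ≤ (c * n) ^ m / m!`, which tends to `0`
for small `c`: since `α < 1 / k`, the number `m` grows linearly in `n`, and `m! ≥ (m / e) ^ m`.
-/

open MeasureTheory ProbabilityTheory SimpleGraph unitInterval

namespace PerturbedSquare

section GraphPower

variable {V W : Type*} {G : SimpleGraph V} {H : SimpleGraph W}

theorem edist_hom_le (f : G →g H) (u v : V) : H.edist (f u) (f v) ≤ G.edist u v :=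
  le_iInf fun w => by simpa using (w.map f).edist_le

theorem graphPower_map_le (f : V ↪ W) (r : ℕ) (h : G.map f ≤ H) :
    (graphPower G r).map f ≤ graphPower H r := by
  let φ : G →g H := ⟨f, fun huv => (SimpleGraph.map_le_iff_le_comap f G H).1 h huv⟩
  rw [SimpleGraph.map_le_iff_le_comap]
  exact fun u v huv => ⟨f.injective.ne huv.1, (edist_hom_le φ u v).trans huv.2⟩

theorem graphPower_adj_of_walk {r : ℕ} {u v : V} (w : G.Walk u v) (huv : u ≠ v)
    (hw : w.length ≤ r) : (graphPower G r).Adj u v :=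
  ⟨huv, w.edist_le.trans (by exact_mod_cast hw)⟩

end GraphPower

/-- The square of the path on `k` vertices, the graph whose disjoint copies are counted. -/
def squarePath (k : ℕ) : SimpleGraph (Fin k) :=
  graphPower (pathGraph k) 2

theorem squarePath_adj_add_one {k i : ℕ} (h : i + 1 < k) :
    (squarePath k).Adj ⟨i, by omega⟩ ⟨i + 1, h⟩ :=
  graphPower_adj_of_walk (.cons (pathGraph_adj.2 (.inl rfl)) .nil) (by simp) (by simp)

theorem squarePath_adj_add_two {k i : ℕ} (h : i + 2 < k) :
    (squarePath k).Adj ⟨i, by omega⟩ ⟨i + 2, h⟩ :=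
  graphPower_adj_of_walk (.cons (v := ⟨i + 1, by omega⟩) (pathGraph_adj.2 (.inl rfl))
    (.cons (pathGraph_adj.2 (.inl rfl)) .nil)) (by simp) (by simp)

theorem le_ncard_edgeSet_squarePath (k : ℕ) : 2 * k - 3 ≤ (squarePath k).edgeSet.ncard := by
  let edge : Fin (k - 1) ⊕ Fin (k - 2) → Sym2 (Fin k) := Sum.elim
    (fun i => s(⟨i, by omega⟩, ⟨i + 1, by omega⟩)) (fun i => s(⟨i, by omega⟩, ⟨i + 2, by omega⟩))
  have edge_injective : Function.Injective edge := by
    rintro (i | i) (j | j) h <;>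
      simp only [edge, Sum.elim_inl, Sum.elim_inr, Sym2.eq_iff, Fin.mk.injEq] at h <;>
      grind
  have range_edge_subset : Set.range edge ⊆ (squarePath k).edgeSet := by
    rintro _ ⟨i | i, rfl⟩
    · exact squarePath_adj_add_one _
    · exact squarePath_adj_add_two _
  calc 2 * k - 3 = (Set.range edge).ncard := by
        rw [Set.ncard_range_of_injective edge_injective, Nat.card_eq_fintype_card,
          Fintype.card_sum, Fintype.card_fin, Fintype.card_fin]
        omega
    _ ≤ (squarePath k).edgeSet.ncard := Set.ncard_le_ncard range_edge_subset (Set.toFinite _)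

section Packing

variable {V W : Type*}

/-- An `F`-packing in `G`: a finite family of vertex-disjoint copies of `F` in `G`. A copy is
encoded as an embedding of the vertex set of `F`, so it carries a labelling. -/
structure IsPacking (F : SimpleGraph W) (G : SimpleGraph V) (S : Finset (W ↪ V)) : Prop where
  map_le : ∀ s ∈ S, F.map s ≤ G
  pairwiseDisjoint_range : (S : Set (W ↪ V)).PairwiseDisjoint fun s => Set.range s

theorem disjoint_edgeSet_map_of_disjoint_range (F : SimpleGraph W) {s t : W ↪ V}
    (h : Disjoint (Set.range s) (Set.range t)) :
    Disjoint (F.map s).edgeSet (F.map t).edgeSet := by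
  rw [disjoint_edgeSet, disjoint_left]
  rintro _ _ ⟨-, x, -, -, rfl, -⟩ ⟨-, y, -, -, hy, -⟩
  exact Set.disjoint_left.1 h ⟨x, rfl⟩ ⟨y, hy⟩

theorem ncard_edgeSet_iSup_map [Finite W] (F : SimpleGraph W) {S : Finset (W ↪ V)}
    (hS : (S : Set (W ↪ V)).PairwiseDisjoint fun s => Set.range s) :
    (⨆ s ∈ S, F.map s).edgeSet.ncard = S.card * F.edgeSet.ncard := by
  have ncard_map : ∀ s : W ↪ V, (F.map s).edgeSet.ncard = F.edgeSet.ncard := fun s => by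
    rw [edgeSet_map, Set.ncard_image_of_injective _ s.sym2Map.injective]
  have finite_map : ∀ s ∈ (S : Set (W ↪ V)), (F.map s).edgeSet.Finite := fun s _ => by
    rw [edgeSet_map]
    exact F.edgeSet.toFinite.image _
  simp_rw [edgeSet_iSup, ← Finset.mem_coe]
  rw [S.finite_toSet.ncard_biUnion finite_map
    (hS.imp fun s t h => disjoint_edgeSet_map_of_disjoint_range F h)]
  simp only [ncard_map, finsum_mem_coe_finset, Finset.sum_const, smul_eq_mul]

theorem card_filter_not_disjoint_le {ι : Type*} {S : Finset ι} {f : ι → Set V}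
    (hS : (S : Set ι).PairwiseDisjoint f) (A : Finset V)
    [DecidablePred fun i => ¬ Disjoint (f i) A] :
    (S.filter fun i => ¬ Disjoint (f i) A).card ≤ A.card := by
  refine Finset.card_le_card_of_forall_subsingleton (fun i v => v ∈ f i) ?_ ?_
  · intro i hi
    obtain ⟨v, hv, hvA⟩ := Set.not_disjoint_iff.1 (Finset.mem_filter.1 hi).2
    exact ⟨v, hvA, hv⟩
  · rintro v - i ⟨hi, hvi⟩ j ⟨hj, hvj⟩
    exact hS.elim (Finset.mem_filter.1 hi).1 (Finset.mem_filter.1 hj).1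
      (Set.not_disjoint_iff.2 ⟨v, hvi, hvj⟩)

variable {F : SimpleGraph W} {G H : SimpleGraph V} {S T : Finset (W ↪ V)}

theorem IsPacking.subset (hS : IsPacking F G S) (h : T ⊆ S) : IsPacking F G T :=
  ⟨fun s hs => hS.map_le s (h hs), hS.pairwiseDisjoint_range.subset (Finset.coe_subset.2 h)⟩

theorem IsPacking.exists_of_isVertexCover {A : Finset V} (hS : IsPacking F (H ⊔ G) S)
    (hA : H.IsVertexCover A) : ∃ T ⊆ S, T.card = S.card - A.card ∧ IsPacking F G T := by
  classical
  have card_le : S.card - A.card ≤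
      (S.filter fun s : W ↪ V => Disjoint (Set.range s) (A : Set V)).card := by
    have := card_filter_not_disjoint_le hS.pairwiseDisjoint_range A
    have := S.card_filter_add_card_filter_not fun s : W ↪ V => Disjoint (Set.range s) (A : Set V)
    omega
  obtain ⟨T, hTS, hT⟩ := Finset.exists_subset_card_eq card_le
  have hTS' : T ⊆ S := hTS.trans (S.filter_subset _)
  refine ⟨T, hTS', hT, fun s hs => ?_, (hS.subset hTS').pairwiseDisjoint_range⟩
  have avoids : ∀ x, s x ∉ A := fun x =>
    Set.disjoint_left.1 (Finset.mem_filter.1 (hTS hs)).2 ⟨x, rfl⟩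
  rw [SimpleGraph.map_le_iff_le_comap]
  intro x y hxy
  have hsup : (H ⊔ G).Adj (s x) (s y) :=
    (SimpleGraph.map_le_iff_le_comap s F _).1 (hS.map_le s (hTS' hs)) hxy
  exact hsup.resolve_left fun hH => (hA hH).elim (avoids x) (avoids y)

theorem exists_isPacking_of_isContained {J : Type*} [Fintype J] [Nonempty W]
    (h : (⊥ : SimpleGraph J).boxProd F ⊑ G) :
    ∃ S : Finset (W ↪ V), S.card = Fintype.card J ∧ IsPacking F G S := by
  classical
  obtain ⟨f⟩ := h
  let copy (j : J) : W ↪ V := (Function.Embedding.sectR j W).trans f.toEmbedding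
  have disjoint_of_ne : ∀ i j, i ≠ j → Disjoint (Set.range (copy i)) (Set.range (copy j)) := by
    intro i j hij
    rw [Set.disjoint_left]
    rintro _ ⟨x, rfl⟩ ⟨y, hxy⟩
    exact hij (congrArg Prod.fst (f.injective hxy)).symm
  have copy_injective : Function.Injective copy := fun i j hij => by
    by_contra hne
    exact (Set.range_nonempty (copy i)).ne_empty
      (disjoint_self.1 (by simpa only [hij] using disjoint_of_ne i j hne))
  refine ⟨Finset.univ.image copy, Finset.card_image_of_injective _ copy_injective, ?_, ?_⟩
  · simp only [Finset.mem_image, Finset.mem_univ, true_and, forall_exists_index,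
      forall_apply_eq_imp_iff]
    intro j
    rw [SimpleGraph.map_le_iff_le_comap]
    exact fun x y hxy => f.toHom.map_adj (boxProd_adj.2 (.inr ⟨hxy, rfl⟩))
  · intro _ hs _ ht hst
    obtain ⟨i, -, rfl⟩ := Finset.mem_image.1 hs
    obtain ⟨j, -, rfl⟩ := Finset.mem_image.1 ht
    exact disjoint_of_ne i j fun hij => hst (congrArg copy hij)

end Packing

theorem bot_boxProd_squarePath_isContained (n k : ℕ) :
    (⊥ : SimpleGraph (Fin (n / k))).boxProd (squarePath k) ⊑ squareCycle n := by
  let e : Fin (n / k) × Fin k ↪ Fin n :=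
    finProdFinEquiv.toEmbedding.trans (Fin.castLEEmb (Nat.div_mul_le_self n k))
  let block (j : Fin (n / k)) : Fin k ↪ Fin n := (Function.Embedding.sectR j _).trans e
  have pathGraph_map_block_le : ∀ j, (pathGraph k).map (block j) ≤ cycleGraph n := fun j => by
    rw [SimpleGraph.map_le_iff_le_comap]
    refine fun i i' h => pathGraph_le_cycleGraph (pathGraph_adj.2 ?_)
    have val_block : ∀ i, (block j i : ℕ) = i + k * j := fun _ => rfl
    have := pathGraph_adj.1 h
    rw [val_block, val_block]
    omega
  refine isContained_iff_exists_le_comap.2 ⟨e, ?_⟩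
  rintro ⟨j, i⟩ ⟨j', i'⟩ h
  obtain ⟨h, -⟩ | ⟨h, rfl⟩ := boxProd_adj.1 h
  · exact h.elim
  · exact (SimpleGraph.map_le_iff_le_comap _ _ _).1
      (graphPower_map_le (block j) 2 (pathGraph_map_block_le j)) h

theorem exists_isPacking_squarePath {n k : ℕ} (hk : 0 < k) {G H : SimpleGraph (Fin n)}
    {A : Finset (Fin n)} (hA : H.IsVertexCover A) (h : squareCycle n ⊑ H ⊔ G) :
    ∃ S : Finset (Fin k ↪ Fin n), S.card = n / k - A.card ∧ IsPacking (squarePath k) G S := by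
  have : Nonempty (Fin k) := ⟨⟨0, hk⟩⟩
  obtain ⟨S, hS, hpack⟩ :=
    exists_isPacking_of_isContained ((bot_boxProd_squarePath_isContained n k).trans h)
  obtain ⟨T, -, hT, hpack⟩ := hpack.exists_of_isVertexCover hA
  exact ⟨T, by rw [hT, hS, Fintype.card_fin], hpack⟩

theorem isVertexCover_completeBipartiteOn {V : Type*} (A : Finset V) :
    (completeBipartiteOn A).IsVertexCover A := by
  intro u v h
  exact (between_adj.1 h).2.imp And.left And.right

section RandomGraph

variable {V W ι : Type*} (p : I)

theorem setBernoulli_Ici [Countable ι] {u : Set ι} {T : Finset ι} (hT : (T : Set ι) ⊆ u) :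
    setBernoulli u p (Set.Ici (T : Set ι)) = (toNNReal p : ENNReal) ^ T.card := by
  have preimage_eq : (fun q : ι → Prop => {i | q i}) ⁻¹' Set.Ici (T : Set ι) =
      Set.pi T fun _ => {True} := by
    ext q
    simp [Set.subset_def, Set.mem_pi]
  rw [setBernoulli_apply', preimage_eq, Measure.infinitePi_pi _ fun _ _ => .of_discrete,
    ← Finset.prod_const]
  refine Finset.prod_congr rfl fun i hi => ?_
  simp [hT hi]

theorem binomialRandom_Ici [Countable V] {F : SimpleGraph V} (hF : F.edgeSet.Finite) :
    binomialRandom V p (Set.Ici F) = (toNNReal p : ENNReal) ^ F.edgeSet.ncard := by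
  have image_ae_eq : edgeSet '' Set.Ici F =ᵐ[setBernoulli Sym2.diagSetᶜ p]
      Set.Ici (hF.toFinset : Set (Sym2 V)) := by
    filter_upwards [setBernoulli_ae_subset] with s hs
    rw [hF.coe_toFinset]
    refine propext ⟨?_, fun h => ?_⟩
    · rintro ⟨G, hG, rfl⟩
      exact edgeSet_subset_edgeSet.2 hG
    · obtain ⟨G, rfl⟩ : ∃ G : SimpleGraph V, G.edgeSet = s :=
        ⟨fromEdgeSet s, (edgeSet_fromEdgeSet s).trans
          (Set.subset_compl_iff_disjoint_right.1 hs).sdiff_eq_left⟩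
      exact ⟨G, edgeSet_subset_edgeSet.1 h, rfl⟩
  rw [binomialRandom_apply', measure_congr image_ae_eq, setBernoulli_Ici p (by simp),
    Set.ncard_eq_toFinset_card _ hF]

theorem binomialRandom_real_Ici [Countable V] {F : SimpleGraph V} (hF : F.edgeSet.Finite) :
    (binomialRandom V p).real (Set.Ici F) = (p : ℝ) ^ F.edgeSet.ncard := by
  simp [Measure.real, binomialRandom_Ici p hF]

theorem choose_card_embedding_le (V W : Type*) [Fintype V] [Fintype W] [Fintype (W ↪ V)] (m : ℕ) :
    ((Fintype.card (W ↪ V)).choose m : ℝ) ≤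
      ((Fintype.card V : ℝ) ^ Fintype.card W) ^ m / m.factorial := calc
  ((Fintype.card (W ↪ V)).choose m : ℝ)
      ≤ (Fintype.card (W ↪ V) : ℝ) ^ m / m.factorial := Nat.choose_le_pow_div m _
  _ ≤ ((Fintype.card V : ℝ) ^ Fintype.card W) ^ m / m.factorial := by
      gcongr
      rw [Fintype.card_embedding_eq]
      exact_mod_cast Nat.descFactorial_le_pow _ _

theorem binomialRandom_real_exists_isPacking_le [Fintype V] [Fintype W] (F : SimpleGraph W)
    (m : ℕ) :
    (binomialRandom V p).real {G | ∃ S : Finset (W ↪ V), S.card = m ∧ IsPacking F G S} ≤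
      ((Fintype.card V : ℝ) ^ Fintype.card W * (p : ℝ) ^ F.edgeSet.ncard) ^ m / m.factorial := by
  classical
  let P := (Finset.powersetCard m (Finset.univ : Finset (W ↪ V))).filter fun S : Finset (W ↪ V) =>
    (S : Set (W ↪ V)).PairwiseDisjoint fun s => Set.range s
  have card_P_le : P.card ≤ (Fintype.card (W ↪ V)).choose m := by
    rw [← Finset.card_univ, ← Finset.card_powersetCard]
    exact Finset.card_filter_le _ _
  have subset_iUnion : {G | ∃ S : Finset (W ↪ V), S.card = m ∧ IsPacking F G S} ⊆
      ⋃ S ∈ P, Set.Ici (⨆ s ∈ S, F.map s) := by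
    rintro G ⟨S, hSm, hS⟩
    refine Set.mem_biUnion (x := S) ?_ (Set.mem_Ici.2 (iSup₂_le hS.map_le))
    simpa [P, hSm] using hS.pairwiseDisjoint_range
  have real_Ici_eq : ∀ S ∈ P, (binomialRandom V p).real (Set.Ici (⨆ s ∈ S, F.map s)) =
      (p : ℝ) ^ (m * F.edgeSet.ncard) := fun S hS => by
    obtain ⟨hSm, hS⟩ := Finset.mem_filter.1 hS
    rw [binomialRandom_real_Ici p (Set.toFinite _), ncard_edgeSet_iSup_map F hS,
      (Finset.mem_powersetCard.1 hSm).2]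
  calc (binomialRandom V p).real {G | ∃ S : Finset (W ↪ V), S.card = m ∧ IsPacking F G S}
      ≤ (binomialRandom V p).real (⋃ S ∈ P, Set.Ici (⨆ s ∈ S, F.map s)) :=
        measureReal_mono subset_iUnion (measure_ne_top _ _)
    _ ≤ ∑ S ∈ P, (binomialRandom V p).real (Set.Ici (⨆ s ∈ S, F.map s)) :=
        measureReal_biUnion_finset_le _ _
    _ = P.card * (p : ℝ) ^ (m * F.edgeSet.ncard) := by
        rw [Finset.sum_congr rfl real_Ici_eq, Finset.sum_const, nsmul_eq_mul]
    _ ≤ ((Fintype.card V : ℝ) ^ Fintype.card W) ^ m / m.factorial *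
          (p : ℝ) ^ (m * F.edgeSet.ncard) := by
        refine mul_le_mul_of_nonneg_right ?_ (pow_nonneg p.2.1 _)
        exact (Nat.cast_le.2 card_P_le).trans (choose_card_embedding_le V W m)
    _ = ((Fintype.card V : ℝ) ^ Fintype.card W * (p : ℝ) ^ F.edgeSet.ncard) ^ m /
          m.factorial := by ring

theorem binomialRandom_real_squareCycle_isContained_le {n k : ℕ} (hk : 0 < k)
    {H : SimpleGraph (Fin n)} {A : Finset (Fin n)} (hA : H.IsVertexCover A) :
    (binomialRandom (Fin n) p).real {G | squareCycle n ⊑ H ⊔ G} ≤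
      ((n : ℝ) ^ k * (p : ℝ) ^ (2 * k - 3)) ^ (n / k - A.card) / (n / k - A.card).factorial := by
  refine (measureReal_mono fun G hG => exists_isPacking_squarePath hk hA hG).trans <|
    (binomialRandom_real_exists_isPacking_le p _ _).trans ?_
  rw [Fintype.card_fin, Fintype.card_fin]
  have := p.2.1
  gcongr (?_ * ?_) ^ _ / _
  exact pow_le_pow_of_le_one p.2.1 p.2.2 (le_ncard_edgeSet_squarePath k)

end RandomGraph

section Asymptotics

theorem tendsto_measure_compl_one_of_tendsto_measureReal_zero {ι : Type*} {l : Filter ι}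
    {Ω : ι → Type*} [∀ i, MeasurableSpace (Ω i)] {μ : ∀ i, Measure (Ω i)}
    [∀ i, IsProbabilityMeasure (μ i)] {s : ∀ i, Set (Ω i)}
    (h : Tendsto (fun i => (μ i).real (s i)) l (𝓝 0)) :
    Tendsto (fun i => μ i (s i)ᶜ) l (𝓝 1) := by
  have h' : Tendsto (fun i => 1 - μ i (s i)) l (𝓝 1) := by
    simpa [Measure.real] using ENNReal.Tendsto.sub (tendsto_const_nhds (x := (1 : ENNReal)))
      (ENNReal.tendsto_ofReal h) (.inl ENNReal.one_ne_top)
  refine tendsto_of_tendsto_of_tendsto_of_le_of_le h' tendsto_const_nhds (fun i => ?_)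
    fun i => prob_le_one
  simpa [Set.compl_eq_univ_sdiff] using le_measure_sdiff (μ := μ i) (s₁ := Set.univ) (s₂ := s i)

theorem pow_div_factorial_le {m : ℕ} {x : ℝ} (hx0 : 0 ≤ x) (hx : x ≤ m / 6) :
    x ^ m / m.factorial ≤ (1 / 2) ^ m := calc
  x ^ m / m.factorial ≤ (m / 6 : ℝ) ^ m / m.factorial := by gcongr
  _ = (m : ℝ) ^ m / m.factorial * (1 / 6) ^ m := by ring
  _ ≤ Real.exp m * (1 / 6) ^ m := by
      gcongr
      exact Real.pow_div_factorial_le_exp _ m.cast_nonneg m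
  _ = (Real.exp 1 / 6) ^ m := by rw [← Real.exp_one_pow]; ring
  _ ≤ (1 / 2) ^ m := pow_le_pow_left₀ (by positivity) (by linarith [Real.exp_one_lt_three]) m

theorem tendsto_pow_div_factorial {ι : Type*} {l : Filter ι} {m : ι → ℕ} {x : ι → ℝ}
    (hm : Tendsto m l atTop) (hx0 : ∀ᶠ i in l, 0 ≤ x i) (hx : ∀ᶠ i in l, x i ≤ m i / 6) :
    Tendsto (fun i => x i ^ m i / (m i).factorial) l (𝓝 0) := by
  have geometric : Tendsto (fun i => (1 / 2 : ℝ) ^ m i) l (𝓝 0) :=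
    (tendsto_pow_atTop_nhds_zero_of_lt_one (by norm_num) (by norm_num)).comp hm
  refine squeeze_zero' ?_ ?_ geometric
  · filter_upwards [hx0] with i hi
    positivity
  · filter_upwards [hx0, hx] with i h0 h
    exact pow_div_factorial_le h0 h

theorem pow_mul_pow_le_of_le_rpow {k : ℕ} (hk : 2 ≤ k) {c p x : ℝ} (hx : 0 < x) (hp0 : 0 ≤ p)
    (hp : p ≤ c * x ^ (-(((k : ℝ) - 1) / (2 * (k : ℝ) - 3)))) :
    x ^ k * p ^ (2 * k - 3) ≤ c ^ (2 * k - 3) * x := by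
  have cast_exponent : ((2 * k - 3 : ℕ) : ℝ) = 2 * k - 3 := by
    rw [Nat.cast_sub (by omega)]
    norm_num
  have exponent_mul : -(((k : ℝ) - 1) / (2 * k - 3)) * (2 * k - 3) = 1 - k := by
    have : 2 * (k : ℝ) - 3 ≠ 0 := by
      rw [← cast_exponent]
      exact_mod_cast (by omega : 2 * k - 3 ≠ 0)
    rw [neg_mul, div_mul_cancel₀ _ this, neg_sub]
  calc x ^ k * p ^ (2 * k - 3)
      ≤ x ^ k * (c * x ^ (-(((k : ℝ) - 1) / (2 * k - 3)))) ^ (2 * k - 3) := by gcongr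
    _ = c ^ (2 * k - 3) * (x ^ (k : ℝ) * x ^ (1 - k : ℝ)) := by
        rw [mul_pow, ← Real.rpow_mul_natCast hx.le, cast_exponent, exponent_mul,
          Real.rpow_natCast]
        ring
    _ = c ^ (2 * k - 3) * x := by rw [← Real.rpow_add hx, add_sub_cancel, Real.rpow_one]

theorem le_natCast_div_sub {k n a : ℕ} {α : ℝ} (ha : a ≤ α * n + 1) :
    (1 / (k : ℝ) - α) * n - 2 ≤ ((n / k - a : ℕ) : ℝ) := calc
  (1 / (k : ℝ) - α) * n - 2 = n / k - 1 - (α * n + 1) := by ring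
  _ ≤ (n / k : ℕ) - a := by
    rw [← Nat.floor_div_eq_div (K := ℝ)]
    linarith [Nat.lt_floor_add_one ((n : ℝ) / k)]
  _ ≤ ((n / k - a : ℕ) : ℝ) := sub_le_iff_le_add.2 (by exact_mod_cast le_tsub_add)

end Asymptotics

end PerturbedSquare

open PerturbedSquare

theorem proposition3p1_general {k : ℕ} (hk : 2 ≤ k) {α : ℝ} (hα : α < 1 / (k : ℝ)) :
    ∃ c : ℝ, 0 < c ∧ c < 1 ∧
      ∀ (H : (n : ℕ) → SimpleGraph (Fin n)) (A : (n : ℕ) → Finset (Fin n)),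
        (∀ n, (H n).IsVertexCover (A n)) → (∀ n, ((A n).card : ℝ) ≤ α * n + 1) →
      ∀ p : ℕ → I,
        (∀ᶠ n : ℕ in atTop,
          (p n : ℝ) ≤ c * (n : ℝ) ^ (-(((k : ℝ) - 1) / (2 * (k : ℝ) - 3)))) →
        Tendsto (fun n : ℕ => binomialRandom (Fin n) (p n) {G | ¬ squareCycle n ⊑ H n ⊔ G})
          atTop (𝓝 1) := by
  have hδ : 0 < 1 / (k : ℝ) - α := sub_pos.2 hα
  obtain ⟨c, hc0, hc⟩ := exists_between (lt_min one_pos (div_pos hδ (by norm_num : (0 : ℝ) < 12)))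
  obtain ⟨hc1, hcδ⟩ := lt_min_iff.1 hc
  refine ⟨c, hc0, hc1, fun H A hA hcard p hp =>
    tendsto_measure_compl_one_of_tendsto_measureReal_zero ?_⟩
  have le_copies n : (1 / (k : ℝ) - α) * n - 2 ≤ ((n / k - (A n).card : ℕ) : ℝ) :=
    le_natCast_div_sub (hcard n)
  have linear_atTop : Tendsto (fun n : ℕ => (1 / (k : ℝ) - α) * n - 2) atTop atTop :=
    tendsto_atTop_add_const_right _ _ (tendsto_natCast_atTop_atTop.const_mul_atTop hδ)
  have copies_atTop : Tendsto (fun n => n / k - (A n).card) atTop atTop :=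
    tendsto_natCast_atTop_iff.1 (tendsto_atTop_mono le_copies linear_atTop)
  refine squeeze_zero (fun _ => measureReal_nonneg)
    (fun n => binomialRandom_real_squareCycle_isContained_le (p n) (by omega) (hA n))
    (tendsto_pow_div_factorial copies_atTop (.of_forall fun n => ?_) ?_)
  · have := (p n).2.1
    positivity
  filter_upwards [hp, linear_atTop.eventually_ge_atTop 2, eventually_gt_atTop 0] with n hpn hn hn0
  calc (n : ℝ) ^ k * (p n : ℝ) ^ (2 * k - 3)
      ≤ c ^ (2 * k - 3) * n := pow_mul_pow_le_of_le_rpow hk (by positivity) (p n).2.1 hpn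
    _ ≤ (1 / (k : ℝ) - α) / 12 * n := by
        gcongr
        exact (pow_le_of_le_one hc0.le hc1.le (by omega)).trans hcδ.le
    _ ≤ ((n / k - (A n).card : ℕ) : ℝ) / 6 := by linarith [le_copies n]

theorem proposition3p1 (k : ℕ) (hk : 2 ≤ k) (α : ℝ)
    (hα : α ∈ Set.Ioo (1 / ((k : ℝ) + 1)) (1 / (k : ℝ))) :
    ∃ c : ℝ, 0 < c ∧ c < 1 ∧
      -- classes of sizes `αn` and `(1 - α)n`, where `αn` may be rounded up or down for each `n`
      ∀ A : (n : ℕ) → Finset (Fin n), (∀ n, |((A n).card : ℝ) - α * n| < 1) →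
      ∀ p : ℕ → unitInterval,
        (∀ᶠ n : ℕ in atTop,
          (p n : ℝ) ≤ c * (n : ℝ) ^ (-(((k : ℝ) - 1) / (2 * (k : ℝ) - 3)))) →
        Tendsto
          (fun n : ℕ => SimpleGraph.binomialRandom (Fin n) (p n)
            {G | ¬ (PerturbedSquare.squareCycle n).IsContained
                (PerturbedSquare.completeBipartiteOn (A n) ⊔ G)})
          atTop (𝓝 1) := by
  obtain ⟨c, hc0, hc1, h⟩ := proposition3p1_general hk hα.2
  exact ⟨c, hc0, hc1, fun A hA => h _ A (fun n => isVertexCover_completeBipartiteOn (A n))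
    fun n => by linarith [(abs_lt.1 (hA n)).2]⟩
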